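/- Call a real $n\times n$ matrix $M=(m_{ij})$ a generalized tournament matrix if all its entries are nonnegative and $M+M^{t}=J_n-I_n$, where $J_n$ is the all-ones matrix and $I_n$ the identity matrix. A clan of $M$ is a subset $X$ of $[n]=\{1,\dots,n\}$ such that $m_{ik}=m_{jk}$ and $m_{ki}=m_{kj}$ for all $i,j\in X$ and all $k\in[n]\setminus X$. The clans $\emptyset$, $\{i\}$ $(i\in[n])$ and $[n]$ are called trivial, and $M$ is indecomposable if all its clans are trivial. For $S\subseteq[n]$, the principal minor of $M$ on $S$ is the determinant of the submatrix $M[S]$ with rows and columns indexed by $S$; its order is $|S|$. Theorem. Let $A$ and $B$ be two $n\times n$ generalized tournament matrices with $n\ge 4$, and suppose that $A$ is indecomposable. If $\det A[S]=\det B[S]$ for every $S\subseteq[n]$ with $|S|\le 4$, then $A=B$ or $A=B^{t}$. -/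

import Mathlib

open scoped Matrix

/-- A generalized tournament matrix: an entrywise nonnegative real matrix with
`M + Mᵗ = J - I`, where `J` is the all-ones matrix. -/
structure IsGeneralizedTournamentMatrix {n : ℕ} (M : Matrix (Fin n) (Fin n) ℝ) : Prop where
  nonneg : ∀ i j, 0 ≤ M i j
  add_transpose : M + Mᵀ = Matrix.of (fun _ _ => (1 : ℝ)) - 1

/-- The principal minor of `M` on the index set `S`: the determinant of the submatrix of `M`
with rows and columns indexed by `S`. Its order is the cardinality of `S`. -/
noncomputable def principalMinor {n : ℕ} (M : Matrix (Fin n) (Fin n) ℝ)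
    (S : Finset (Fin n)) : ℝ :=
  (M.submatrix (fun i : S => (i : Fin n)) (fun i : S => (i : Fin n))).det

/-- `X` is a clan of `M`: every index outside `X` sees all indices of `X` in the same way. -/
def IsClan {n : ℕ} (M : Matrix (Fin n) (Fin n) ℝ) (X : Finset (Fin n)) : Prop :=
  ∀ i ∈ X, ∀ j ∈ X, ∀ k ∉ X, M i k = M j k ∧ M k i = M k j

/-- The trivial clans: the empty set, the singletons, and the whole index set. -/
def IsTrivialClan {n : ℕ} (X : Finset (Fin n)) : Prop :=
  X = ∅ ∨ (∃ i, X = {i}) ∨ X = Finset.univ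

/-- `M` is indecomposable: all its clans are trivial. -/
def IsIndecomposable {n : ℕ} (M : Matrix (Fin n) (Fin n) ℝ) : Prop :=
  ∀ X : Finset (Fin n), IsClan M X → IsTrivialClan X

/-!
Write `s` and `t` for the skew-symmetric parts `A - Aᵗ` and `B - Bᵗ`. Equality of the principal
minors of order two, three and four amounts to equality of the squares `s i j ^ 2`, of the
triangle expressions `s i j * s j k + s j k * s k i + s k i * s i j`, and of the squared Pfaffians
on four indices (`sameMinors_skewPart`). So `t i j = ± s i j`, and every pair `i`, `j` is coloured
`+` (agreement), `-` (disagreement) or `0`. The triangle condition says that no triangle has three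
colours, and that in a triangle with colours `+`, `+`, `-` the common vertex of the two equal edges
does not distinguish their other ends (`SameMinors.ne_zero_of_agree`,
`SameMinors.eq_of_agree`). Hence a connected component of the `+` graph, or of the `-` graph, is a
clan of `A`; if `A` is indecomposable and both colours occur, both graphs are connected.

The heart of the proof is `SameMinors.exists_splits`: a set `W` on which both graphs are connected
splits into two nonempty parts `X`, `Y` with `s` equal to a nonzero constant on `X × Y`. Then for
the whole index set both parts are clans, which contradicts indecomposability, so that only one
colour occurs and `t = s` or `t = -s`. The splitting is found by induction on the size of `W`. If
deleting some vertex `k` disconnects one of the graphs, the parts are read off from a component of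
the rest, and the Pfaffian condition on an alternating 4-path through `k` gives the value on `k`
(`SameMinors.exists_splits_of_erase`). Otherwise every vertex-deleted subset splits by induction,
and a statement about skew-symmetric functions alone, a version of Moon's theorem on vertex-deleted
strong tournaments, shows that `W` splits (`exists_splits_of_forall_erase`).
-/

/-! ### Splittings of a skew-symmetric function -/

section Splitting

variable {V : Type*} [DecidableEq V] {s t : V → V → ℝ} {m : ℝ} {W : Finset V}

/-- `W` is the union of two nonempty parts `X` and `Y` such that `s` takes the constant value `m`
on `X × Y`. For skew-symmetric `s` and `m ≠ 0` the two parts are automatically disjoint. -/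
def Splits (s : V → V → ℝ) (m : ℝ) (W : Finset V) : Prop :=
  ∃ X Y : Finset V, X.Nonempty ∧ Y.Nonempty ∧ X ∪ Y = W ∧ ∀ x ∈ X, ∀ y ∈ Y, s x y = m

lemma Splits.neg_value (hs : ∀ i j, s i j = -s j i) (h : Splits s m W) : Splits s (-m) W := by
  obtain ⟨X, Y, hX, hY, hXY, h⟩ := h
  refine ⟨Y, X, hY, hX, by rw [Finset.union_comm, hXY], fun y hy x hx => ?_⟩
  rw [hs, h x hx y hy]

lemma Splits.swap (h : Splits s m W) : Splits (fun i j => s j i) m W := by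
  obtain ⟨X, Y, hX, hY, hXY, h⟩ := h
  exact ⟨Y, X, hY, hX, by rw [Finset.union_comm, hXY], fun y hy x hx => h x hx y hy⟩

lemma Splits.exists_pos (hs : ∀ i j, s i j = -s j i) (hm : m ≠ 0) (h : Splits s m W) :
    ∃ m', 0 < m' ∧ Splits s m' W := by
  rcases lt_or_gt_of_ne hm with h0 | h0
  · exact ⟨-m, by linarith, h.neg_value hs⟩
  · exact ⟨m, h0, h⟩

lemma subset_or_subset_of_not_splits {X Y : Finset V} (hW : ¬ Splits s m W) (hXY : W ⊆ X ∪ Y)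
    (h : ∀ x ∈ X, ∀ y ∈ Y, s x y = m) : W ⊆ X ∨ W ⊆ Y := by
  by_contra! hcon
  obtain ⟨h1, h2⟩ := hcon
  obtain ⟨a, haW, haX⟩ := Finset.not_subset.1 h1
  obtain ⟨b, hbW, hbY⟩ := Finset.not_subset.1 h2
  refine hW ⟨W ∩ X, W ∩ Y, ⟨b, ?_⟩, ⟨a, ?_⟩, ?_, ?_⟩ <;> grind

/-- A set all of whose vertex-deleted subsets split with the same value splits itself. In terms of
the semicomplete digraph with an arc `i → j` whenever `s i j ≠ -m`, a set splits iff it is not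
strongly connected, so this is Moon's theorem that a strong tournament on at least four vertices
has a vertex whose deletion leaves it strong. -/
lemma splits_of_forall_erase (hs : ∀ i j, s i j = -s j i) (hm : m ≠ 0) (hW : 4 ≤ W.card)
    (h : ∀ j ∈ W, Splits s m (W.erase j)) : Splits s m W := by
  by_contra hns
  classical
  -- a largest nonempty proper subset of `W` that does not split
  let F := W.powerset.filter (fun U => U.Nonempty ∧ U ≠ W ∧ ¬ Splits s m U)
  have hF : F.Nonempty := by
    obtain ⟨w, hw⟩ : W.Nonempty := Finset.card_pos.1 (by omega)
    refine ⟨{w}, ?_⟩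
    simp only [F, Finset.mem_filter, Finset.mem_powerset, Finset.singleton_subset_iff]
    refine ⟨hw, by simp, ?_, ?_⟩
    · intro h1
      rw [← h1, Finset.card_singleton] at hW
      omega
    · rintro ⟨X, Y, ⟨x, hx⟩, ⟨y, hy⟩, hXY, hc⟩
      have := hc x hx y hy
      have h1 : x = w := by simpa [hXY] using Finset.mem_union_left Y hx
      have h2 : y = w := by simpa [hXY] using Finset.mem_union_right X hy
      rw [h1, h2] at this
      have := hs w w
      exact hm (by linarith)
  obtain ⟨U, hU, hmax⟩ := Finset.exists_max_image F Finset.card hF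
  simp only [F, Finset.mem_filter, Finset.mem_powerset] at hU hmax
  obtain ⟨hUW, ⟨u, hu⟩, hUne, hUns⟩ := hU
  have hbig : ∀ U', U' ⊆ W → U ⊆ U' → ¬ Splits s m U' → U' = U ∨ U' = W := by
    intro U' h1 h2 h3
    by_contra! hcon
    have := hmax U' ⟨h1, ⟨u, h2 hu⟩, hcon.2, h3⟩
    exact hcon.1 (Finset.eq_of_subset_of_card_le h2 this).symm
  have key : ∀ v ∈ W, v ∉ U → (∀ w ∈ U, s v w = m) ∨ (∀ w ∈ U, s w v = m) := by
    intro v hv hvU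
    have hsp : Splits s m (insert v U) := by
      by_contra hcon
      rcases hbig _ (Finset.insert_subset hv hUW) (Finset.subset_insert v U) hcon with h1 | h1
      · exact hvU (h1 ▸ Finset.mem_insert_self v U)
      · have h2 := h v hv
        rw [← h1, Finset.erase_insert hvU] at h2
        exact hUns h2
    obtain ⟨X, Y, ⟨x, hx⟩, ⟨y, hy⟩, hXY, hc⟩ := hsp
    rcases subset_or_subset_of_not_splits (X := X) (Y := Y) hUns (by rw [hXY]; simp) hc
      with h1 | h1
    · right
      have : y = v := by
        have hy' : y ∈ insert v U := hXY ▸ Finset.mem_union_right X hy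
        rcases Finset.mem_insert.1 hy' with h2 | h2
        · exact h2
        · have := hc y (h1 h2) y hy
          have := hs y y
          exact absurd (by linarith) hm
      exact fun w hw => this ▸ hc w (h1 hw) y hy
    · left
      have : x = v := by
        have hx' : x ∈ insert v U := hXY ▸ Finset.mem_union_left Y hx
        rcases Finset.mem_insert.1 hx' with h2 | h2
        · exact h2
        · have := hc x hx x (h1 h2)
          have := hs x x
          exact absurd (by linarith) hm
      exact fun w hw => this ▸ hc x hx w (h1 hw)
  -- vertices `a` above and `b` below `U` that close up to a strong set
  obtain ⟨a, haW, haU, ha, b, hbW, hbU, hb, hab⟩ : ∃ a ∈ W, a ∉ U ∧ (∀ w ∈ U, s a w = m) ∧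
      ∃ b ∈ W, b ∉ U ∧ (∀ w ∈ U, s w b = m) ∧ s a b ≠ m := by
    by_contra! hcon
    obtain ⟨v, hv, hvU⟩ : ∃ v ∈ W, v ∉ U := by
      by_contra! h1
      exact hUne (Finset.Subset.antisymm hUW h1)
    by_cases hA : ∃ a ∈ W, a ∉ U ∧ ∀ w ∈ U, s a w = m
    · obtain ⟨a, haW, haU, ha⟩ := hA
      refine hns ⟨W.filter (fun a => a ∉ U ∧ ∀ w ∈ U, s a w = m),
        W.filter (fun a => ¬ (a ∉ U ∧ ∀ w ∈ U, s a w = m)), ⟨a, by grind⟩, ⟨u, by grind⟩,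
        Finset.filter_union_filter_not_eq _ W, ?_⟩
      intro x hx y hy
      simp only [Finset.mem_filter] at hx hy
      by_cases hyU : y ∈ U
      · exact hx.2.2 y hyU
      · rcases key y hy.1 hyU with h1 | h1
        · exact absurd ⟨hyU, h1⟩ hy.2
        · exact hcon x hx.1 hx.2.1 hx.2.2 y hy.1 hyU h1
    · refine hns ⟨U, W \ U, ⟨u, hu⟩, ⟨v, by grind⟩, Finset.union_sdiff_of_subset hUW, ?_⟩
      intro x hx y hy
      simp only [Finset.mem_sdiff] at hy
      rcases key y hy.1 hy.2 with h1 | h1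
      · exact absurd ⟨y, hy.1, hy.2, h1⟩ hA
      · exact h1 x hx
  -- `a`, `b` and any nonempty part of `U` form a strong set, through the cycles `u → b → a → u`
  have hcyc : ∀ U' ⊆ U, U'.Nonempty → ¬ Splits s m (insert a (insert b U')) := by
    rintro U' hU' ⟨z, hz⟩ ⟨X, Y, ⟨x, hx⟩, ⟨y, hy⟩, hXY, hc⟩
    have hne : ∀ x y, s x y = m → s y x ≠ m := by
      intro x y h1 h2
      have := hs x y
      exact hm (by linarith)
    have hmem : ∀ z, (z ∈ X ∨ z ∈ Y) ↔ (z = a ∨ z = b ∨ z ∈ U') := by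
      intro z
      rw [← Finset.mem_union, hXY, Finset.mem_insert, Finset.mem_insert]
    rcases (hmem a).2 (Or.inl rfl) with haX | haY
    · have hbX : b ∈ X := ((hmem b).2 (Or.inr (Or.inl rfl))).resolve_right
        fun h1 => hab (hc a haX b h1)
      rcases (hmem y).1 (Or.inr hy) with rfl | rfl | h1
      · exact hne _ _ (hc y haX y hy) (hc y haX y hy)
      · exact hne _ _ (hc y hbX y hy) (hc y hbX y hy)
      · exact hne _ _ (hc b hbX y hy) (hb y (hU' h1))
    · have hU'Y : ∀ w ∈ U', w ∈ Y := fun w hw =>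
        ((hmem w).2 (Or.inr (Or.inr hw))).resolve_left
          fun h1 => hne _ _ (hc w h1 a haY) (ha w (hU' hw))
      rcases (hmem x).1 (Or.inl hx) with rfl | rfl | h1
      · exact hne _ _ (hc x hx x haY) (hc x hx x haY)
      · exact hne _ _ (hc x hx z (hU'Y z hz)) (hb z (hU' hz))
      · exact hne _ _ (hc x hx x (hU'Y x h1)) (hc x hx x (hU'Y x h1))
  have hWU : insert a (insert b U) = W := by
    rcases hbig _ (by grind) (by grind) (hcyc U subset_rfl ⟨u, hu⟩) with h3 | h3
    · exact absurd (h3 ▸ Finset.mem_insert_self _ _) haU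
    · exact h3
  -- as `U` has at least two elements, deleting `u` contradicts the hypothesis
  have hcard : 2 ≤ U.card := by
    have h1 := Finset.card_insert_le a (insert b U)
    have h2 := Finset.card_insert_le b U
    rw [hWU] at h1
    omega
  refine hcyc (U.erase u) (Finset.erase_subset _ _) ?_ ?_
  · rw [← Finset.card_pos, Finset.card_erase_of_mem hu]
    omega
  · have h1 := h u (hUW hu)
    have h2 : W.erase u = insert a (insert b (U.erase u)) := by
      rw [← hWU, Finset.erase_insert_of_ne (by grind), Finset.erase_insert_of_ne (by grind)]
    rwa [h2] at h1

lemma eq_of_splits_erase {j k : V} {m m' : ℝ} {X Y X' Y' : Finset V}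
    (hs : ∀ i j, s i j = -s j i) (hm : 0 < m) (hm' : 0 < m') (hXY : X ∪ Y = W.erase j)
    (h : ∀ x ∈ X, ∀ y ∈ Y, s x y = m) (hXY' : X' ∪ Y' = W.erase k)
    (h' : ∀ x ∈ X', ∀ y ∈ Y', s x y = m') (hX : (X.erase k).Nonempty) (hY : (Y.erase k).Nonempty)
    (hX' : (X'.erase j).Nonempty) (hY' : (Y'.erase j).Nonempty) : m = m' := by
  have hmem : ∀ z, (z ∈ X ∨ z ∈ Y) ↔ (z ≠ j ∧ z ∈ W) := by
    intro z; rw [← Finset.mem_union, hXY, Finset.mem_erase]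
  have hmem' : ∀ z, (z ∈ X' ∨ z ∈ Y') ↔ (z ≠ k ∧ z ∈ W) := by
    intro z; rw [← Finset.mem_union, hXY', Finset.mem_erase]
  obtain ⟨x, hx⟩ := hX
  obtain ⟨y, hy⟩ := hY
  obtain ⟨x', hx'⟩ := hX'
  obtain ⟨y', hy'⟩ := hY'
  rw [Finset.mem_erase] at hx hy hx' hy'
  by_cases h1 : ∃ p ∈ X, p ∈ X'
  · obtain ⟨p, hp, hp'⟩ := h1
    by_cases h2 : ∃ q ∈ Y, q ∈ Y'
    · obtain ⟨q, hq, hq'⟩ := h2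
      rw [← h p hp q hq, h' p hp' q hq']
    · push Not at h2
      have h3 : y ∈ X' := by grind
      have h4 : y' ∈ X := by grind
      have h5 := h y' h4 y hy.2
      have h6 := h' y h3 y' hy'.2
      have := hs y y'
      linarith
  · push Not at h1
    have h3 : x ∈ Y' := by grind
    have h4 : x' ∈ Y := by grind
    have h5 := h x hx.2 x' h4
    have h6 := h' x' hx'.2 x h3
    have := hs x x'
    linarith

/-- If `k` dominates `W \ {j, k}` with value `m`, while `W \ {k}` splits with a different value,
and all vertex-deleted subsets of `W` split, then `W` splits. Deleting any `l` other than `j` and `k`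
either isolates `j` in its part or keeps the value `m`; the latter makes `{l}` a part of `W \ {k}`,
because the values `m` and `m'` are different. -/
lemma exists_splits_of_dominates {j k : V} {m m' : ℝ} (hs : ∀ i j, s i j = -s j i)
    (hW : 5 ≤ W.card) (hj : j ∈ W) (hk : k ∈ W) (hjk : j ≠ k) (hm : 0 < m) (hm' : 0 < m')
    (hmm : m ≠ m') (hdom : ∀ u ∈ W, u ≠ j → u ≠ k → s k u = m)
    (hsk : Splits s m' (W.erase k)) (h : ∀ l ∈ W, ∃ m, 0 < m ∧ Splits s m (W.erase l)) :
    ∃ m, m ≠ 0 ∧ Splits s m W := by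
  by_cases hkj : s k j = m
  · refine ⟨m, hm.ne', {k}, W.erase k, by simp, ⟨j, by grind⟩, by grind, ?_⟩
    intro x hx y hy
    grind
  -- every other vertex `l` either leaves a splitting with `j` and `k` both in the upper part, or
  -- leaves `j` alone in its part
  have key : ∀ l ∈ W, l ≠ j → l ≠ k →
      (s k j ≠ 0 ∧ ∀ u ∈ W, u ≠ l → u ≠ j → s u j = s k j) ∨
      ∃ X Y, j ∈ X ∧ k ∈ X ∧ Y.Nonempty ∧ X ∪ Y = W.erase l ∧ ∀ x ∈ X, ∀ y ∈ Y, s x y = m := by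
    intro l hl hlj hlk
    obtain ⟨c, hc, X, Y, ⟨x, hx⟩, ⟨y, hy⟩, hXY, hcc⟩ := h l hl
    have hmem : ∀ z, (z ∈ X ∨ z ∈ Y) ↔ (z ≠ l ∧ z ∈ W) := by
      intro z; rw [← Finset.mem_union, hXY, Finset.mem_erase]
    have hself : ∀ z, s z z = 0 := fun z => by have := hs z z; linarith
    have hdisj : ∀ z ∈ X, z ∉ Y := by
      intro z h1 h2
      have := hcc z h1 z h2
      rw [hself] at this
      linarith
    rcases (hmem k).2 ⟨hlk.symm, hk⟩ with hkX | hkY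
    · rcases (hmem j).2 ⟨hlj.symm, hj⟩ with hjX | hjY
      · right
        have h1 : c = m := by
          rw [← hcc k hkX y hy]
          have := (hmem y).1 (Or.inr hy)
          exact hdom y this.2 (by rintro rfl; exact hdisj _ hjX hy)
            (by rintro rfl; exact hdisj _ hkX hy)
        exact ⟨X, Y, hjX, hkX, ⟨y, hy⟩, hXY, h1 ▸ hcc⟩
      · left
        have h1 : s k j = c := hcc k hkX j hjY
        refine ⟨by rw [h1]; exact hc.ne', fun u hu hul huj => ?_⟩
        rcases (hmem u).2 ⟨hul, hu⟩ with huX | huY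
        · rw [h1, hcc u huX j hjY]
        · have h2 := hcc k hkX u huY
          have h3 := hdom u hu huj (by rintro rfl; exact hdisj _ hkX huY)
          exact absurd (by rw [h1, ← h2, h3]) hkj
    · left
      have hX : ∀ z ∈ X, z = j := by
        intro z hz
        by_contra hzj
        have h1 := hdom z ((hmem z).1 (Or.inl hz)).2 hzj (by rintro rfl; exact hdisj _ hz hkY)
        have h2 := hcc z hz k hkY
        have := hs z k
        linarith
      have hjX : j ∈ X := hX x hx ▸ hx
      have h1 := hcc j hjX k hkY
      have h2 := hs j k
      refine ⟨by intro h3; linarith, fun u hu hul huj => ?_⟩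
      have h3 := hcc j hjX u (((hmem u).2 ⟨hul, hu⟩).resolve_left fun h4 => huj (hX u h4))
      have h4 := hs j u
      linarith
  obtain ⟨X', Y', hX', hY', hXY', hc'⟩ := hsk
  have hmem' : ∀ z, (z ∈ X' ∨ z ∈ Y') ↔ (z ≠ k ∧ z ∈ W) := by
    intro z; rw [← Finset.mem_union, hXY', Finset.mem_erase]
  -- two vertices of the second kind force `s · j` to be constant
  have hleft : ∀ l ∈ W, ∀ l' ∈ W, l ≠ l' →
      (s k j ≠ 0 ∧ ∀ u ∈ W, u ≠ l → u ≠ j → s u j = s k j) →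
      (s k j ≠ 0 ∧ ∀ u ∈ W, u ≠ l' → u ≠ j → s u j = s k j) → ∃ m, m ≠ 0 ∧ Splits s m W := by
    intro l hl l' hl' hll h1 h2
    refine ⟨s k j, h1.1, W.erase j, {j}, ⟨k, by grind⟩, by simp, by grind, ?_⟩
    intro x hx y hy
    grind
  -- a vertex of the first kind is alone in its part of `W \ {k}`
  have hright : ∀ l ∈ W, l ≠ j → l ≠ k →
      (∃ X Y, j ∈ X ∧ k ∈ X ∧ Y.Nonempty ∧ X ∪ Y = W.erase l ∧ ∀ x ∈ X, ∀ y ∈ Y, s x y = m) →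
      X' = {l} ∨ Y' = {l} := by
    rintro l hl hlj hlk ⟨X, Y, hjX, hkX, ⟨y, hy⟩, hXY, hc⟩
    by_contra! hcon
    have hky : k ∉ Y := by
      intro h1
      have := hc k hkX k h1
      have := hs k k
      linarith
    refine hmm (eq_of_splits_erase hs hm hm' hXY hc hXY' hc' ⟨j, by grind⟩ ⟨y, by grind⟩ ?_ ?_)
    · rw [Finset.nonempty_iff_ne_empty]
      intro h1
      rcases (Finset.erase_eq_empty_iff _ _).1 h1 with h2 | h2
      · exact hX'.ne_empty h2
      · exact hcon.1 h2
    · rw [Finset.nonempty_iff_ne_empty]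
      intro h1
      rcases (Finset.erase_eq_empty_iff _ _).1 h1 with h2 | h2
      · exact hY'.ne_empty h2
      · exact hcon.2 h2
  have hright2 : ∀ l l', l ≠ l' → (X' = {l} ∨ Y' = {l}) → (X' = {l'} ∨ Y' = {l'}) → False := by
    intro l l' hll h1 h2
    have hle := Finset.card_union_le X' Y'
    rw [hXY', Finset.card_erase_of_mem hk] at hle
    rcases h1 with h1 | h1 <;> rcases h2 with h2 | h2
    · exact hll (Finset.singleton_injective (h1.symm.trans h2))
    · rw [h1, h2, Finset.card_singleton, Finset.card_singleton] at hle; omega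
    · rw [h1, h2, Finset.card_singleton, Finset.card_singleton] at hle; omega
    · exact hll (Finset.singleton_injective (h1.symm.trans h2))
  have hU : 2 < ((W.erase j).erase k).card := by
    rw [Finset.card_erase_of_mem (by grind), Finset.card_erase_of_mem hj]
    omega
  obtain ⟨p, q, r, hp, hq, hr, hpq, hpr, hqr⟩ := Finset.two_lt_card_iff.1 hU
  simp only [Finset.mem_erase] at hp hq hr
  rcases key p hp.2.2 hp.2.1 hp.1 with h1 | h1 <;> rcases key q hq.2.2 hq.2.1 hq.1 with h2 | h2 <;>
    rcases key r hr.2.2 hr.2.1 hr.1 with h3 | h3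
  · exact hleft p hp.2.2 q hq.2.2 hpq h1 h2
  · exact hleft p hp.2.2 q hq.2.2 hpq h1 h2
  · exact hleft p hp.2.2 r hr.2.2 hpr h1 h3
  · exact (hright2 q r hqr (hright q hq.2.2 hq.2.1 hq.1 h2) (hright r hr.2.2 hr.2.1 hr.1 h3)).elim
  · exact hleft q hq.2.2 r hr.2.2 hqr h2 h3
  · exact (hright2 p r hpr (hright p hp.2.2 hp.2.1 hp.1 h1) (hright r hr.2.2 hr.2.1 hr.1 h3)).elim
  · exact (hright2 p q hpq (hright p hp.2.2 hp.2.1 hp.1 h1) (hright q hq.2.2 hq.2.1 hq.1 h2)).elim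
  · exact (hright2 p q hpq (hright p hp.2.2 hp.2.1 hp.1 h1) (hright q hq.2.2 hq.2.1 hq.1 h2)).elim

/-- The same as `splits_of_forall_erase`, but the values may depend on the deleted vertex: two
different values force one of the vertices to be extreme in `W`, up to one exception. -/
lemma exists_splits_of_forall_erase (hs : ∀ i j, s i j = -s j i) (hW : 5 ≤ W.card)
    (h : ∀ j ∈ W, ∃ m, m ≠ 0 ∧ Splits s m (W.erase j)) : ∃ m, m ≠ 0 ∧ Splits s m W := by
  have hpos : ∀ j ∈ W, ∃ m, 0 < m ∧ Splits s m (W.erase j) := fun j hj => by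
    obtain ⟨m, hm, h1⟩ := h j hj
    exact h1.exists_pos hs hm
  obtain ⟨k, hk⟩ : W.Nonempty := Finset.card_pos.1 (by omega)
  obtain ⟨m, hm, hsk⟩ := hpos k hk
  by_cases hall : ∀ j ∈ W, Splits s m (W.erase j)
  · exact ⟨m, hm.ne', splits_of_forall_erase hs hm.ne' (by omega) hall⟩
  push Not at hall
  obtain ⟨j, hj, hsj'⟩ := hall
  obtain ⟨m', hm', hsj⟩ := hpos j hj
  have hmm : m ≠ m' := by
    rintro rfl
    exact hsj' hsj
  have hjk : j ≠ k := by
    rintro rfl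
    exact hsj' hsk
  have hpos' : ∀ l ∈ W, ∃ m, 0 < m ∧ Splits (fun i j => s j i) m (W.erase l) := fun l hl => by
    obtain ⟨m, hm, h1⟩ := hpos l hl
    exact ⟨m, hm, h1.swap⟩
  obtain ⟨X, Y, hX, hY, hXY, hc⟩ := id hsk
  obtain ⟨X', Y', hX', hY', hXY', hc'⟩ := id hsj
  have hmem : ∀ z, (z ∈ X ∨ z ∈ Y) ↔ (z ≠ k ∧ z ∈ W) := by
    intro z; rw [← Finset.mem_union, hXY, Finset.mem_erase]
  have hmem' : ∀ z, (z ∈ X' ∨ z ∈ Y') ↔ (z ≠ j ∧ z ∈ W) := by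
    intro z; rw [← Finset.mem_union, hXY', Finset.mem_erase]
  have hextreme : X = {j} ∨ Y = {j} ∨ X' = {k} ∨ Y' = {k} := by
    by_contra! hcon
    obtain ⟨h1, h2, h3, h4⟩ := hcon
    refine hmm (eq_of_splits_erase hs hm hm' hXY hc hXY' hc' ?_ ?_ ?_ ?_) <;>
      rw [Finset.nonempty_iff_ne_empty, Ne, Finset.erase_eq_empty_iff]
    exacts [not_or.2 ⟨hX.ne_empty, h1⟩, not_or.2 ⟨hY.ne_empty, h2⟩, not_or.2 ⟨hX'.ne_empty, h3⟩,
      not_or.2 ⟨hY'.ne_empty, h4⟩]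
  have hswap : (∃ m, m ≠ 0 ∧ Splits (fun i j => s j i) m W) → ∃ m, m ≠ 0 ∧ Splits s m W := by
    rintro ⟨m, hm, h1⟩
    exact ⟨m, hm, h1.swap⟩
  rcases hextreme with h1 | h1 | h1 | h1 <;> subst h1
  · exact exists_splits_of_dominates hs hW hk hj hjk.symm hm hm' hmm (by grind) hsj hpos
  · exact hswap (exists_splits_of_dominates (fun i j => hs j i) hW hk hj hjk.symm hm hm' hmm
      (by grind) hsj.swap hpos')
  · exact exists_splits_of_dominates hs hW hj hk hjk hm' hm hmm.symm (by grind) hsk hpos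
  · exact hswap (exists_splits_of_dominates (fun i j => hs j i) hW hj hk hjk hm' hm hmm.symm
      (by grind) hsk.swap hpos')

end Splitting

/-! ### Pairs of skew-symmetric functions with the same small minors -/

section Agreement

variable {V : Type*} {s t : V → V → ℝ}

/-- Skew-symmetric functions `s` and `t` whose principal minors of order 2 and 4 coincide,
also after a skew-symmetric bordering by a row of ones: the squares of the entries, the elementary
symmetric expressions of the triangles, and the squared Pfaffians on four indices are the same. -/
structure SameMinors (s t : V → V → ℝ) : Prop where
  skew_left : ∀ i j, s i j = -s j i
  skew_right : ∀ i j, t i j = -t j i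
  sq : ∀ i j, s i j ^ 2 = t i j ^ 2
  triangle : ∀ i j k, s i j * s j k + s j k * s k i + s k i * s i j =
    t i j * t j k + t j k * t k i + t k i * t i j
  pfaffian : ∀ i j k l, (s i j * s k l - s i k * s j l + s i l * s j k) ^ 2 =
    (t i j * t k l - t i k * t j l + t i l * t j k) ^ 2

/-- `s` and `t` agree on the pair `i`, `j`, with a nonzero value. Replacing `t` by `-t` gives the
pairs on which they are opposite. -/
def Agree (s t : V → V → ℝ) (i j : V) : Prop := s i j ≠ 0 ∧ t i j = s i j

/-- The graph of the pairs on which `s` and `t` agree is connected on `W`: each nontrivial cut of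
`W` is crossed by such a pair. -/
def AgreeConnected (s t : V → V → ℝ) (W : Finset V) : Prop :=
  ∀ C ⊆ W, C.Nonempty → C ≠ W → ∃ a ∈ C, ∃ b ∈ W, b ∉ C ∧ Agree s t a b

lemma Agree.not_agree_neg {i j : V} (hij : Agree s t i j) : ¬ Agree s (-t) i j := by
  rintro ⟨h1, h2⟩
  have h3 := hij.2
  simp only [Pi.neg_apply] at h2
  exact h1 (by linarith)

namespace SameMinors

variable (h : SameMinors s t)
include h

lemma neg_right : SameMinors s (-t) where
  skew_left := h.skew_left
  skew_right i j := by simp only [Pi.neg_apply]; rw [h.skew_right i j]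
  sq i j := by simp only [Pi.neg_apply]; rw [h.sq i j]; ring
  triangle i j k := by simp only [Pi.neg_apply]; rw [h.triangle i j k]; ring
  pfaffian i j k l := by simp only [Pi.neg_apply]; rw [h.pfaffian i j k l]; ring

lemma agree_symm {i j : V} (hij : Agree s t i j) : Agree s t j i := by
  obtain ⟨h1, h2⟩ := hij
  rw [h.skew_left] at h1 h2
  rw [h.skew_right] at h2
  exact ⟨by simpa using h1, by linarith⟩

lemma agree_or {i j : V} (hij : s i j ≠ 0) : Agree s t i j ∨ Agree s (-t) i j := by
  rcases sq_eq_sq_iff_eq_or_eq_neg.1 (h.sq i j) with h1 | h1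
  · exact Or.inl ⟨hij, h1.symm⟩
  · exact Or.inr ⟨hij, h1.symm⟩

lemma ne_zero_of_agree {i j k : V} (h1 : Agree s t i j) (h2 : Agree s (-t) i k) : s j k ≠ 0 := by
  intro h0
  have h3 : t j k = 0 := by
    have := h.sq j k
    rw [h0] at this
    simpa using this.symm
  have h4 := h.triangle i j k
  have h5 := h2.2
  have h6 := h.skew_left k i
  have h7 := h.skew_right k i
  simp only [Pi.neg_apply] at h5
  rw [h0, h3, h1.2, h6, h7, show t i k = - s i k by linarith] at h4
  have h8 : s i j * s i k = 0 := by linarith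
  rcases mul_eq_zero.1 h8 with h9 | h9
  · exact h1.1 h9
  · exact h2.1 h9

lemma eq_of_agree {i j k : V} (h1 : Agree s t j i) (h2 : Agree s t j k) (h3 : Agree s (-t) i k) :
    s j i = s j k := by
  have h4 := h.triangle j i k
  have h5 := h3.2
  simp only [Pi.neg_apply] at h5
  rw [h.skew_left k j, h.skew_right k j, h1.2, h2.2, show t i k = - s i k by linarith] at h4
  have h8 : s i k * (s j i - s j k) = 0 := by linarith
  rcases mul_eq_zero.1 h8 with h9 | h9
  · exact absurd h9 h3.1
  · linarith

/-- A vertex that agrees with neither end of an agreeing pair sees both ends in the same way. -/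
lemma eq_of_not_agree {i j k : V} (h1 : Agree s t i j) (h2 : ¬ Agree s t k i)
    (h3 : ¬ Agree s t k j) : s k i = s k j := by
  by_cases h4 : s k i = 0
  · by_cases h5 : s k j = 0
    · rw [h4, h5]
    · have h6 := (h.agree_or h5).resolve_left h3
      have := h.ne_zero_of_agree (h.agree_symm h1) (h.neg_right.agree_symm h6)
      rw [h.skew_left, h4] at this
      simp at this
  · have h6 := (h.agree_or h4).resolve_left h2
    have h7 := h.ne_zero_of_agree h1 (h.neg_right.agree_symm h6)
    rw [h.skew_left] at h7
    have h8 := (h.agree_or (by simpa using h7 : s k j ≠ 0)).resolve_left h3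
    exact h.neg_right.eq_of_agree h6 h8 (by rwa [neg_neg])

/-- On an alternating 4-path all the values of `s` have the same absolute value. -/
lemma sq_eq_of_path {a b k w : V} (hab : Agree s t a b) (hbk : Agree s t b k)
    (hkw : Agree s t k w) (hak : Agree s (-t) a k) (haw : Agree s (-t) a w)
    (hbw : Agree s (-t) b w) : s k b = s k w ∧ s k w ^ 2 = s a w ^ 2 := by
  have h1 := h.eq_of_agree (h.agree_symm hab) hbk hak
  have h2 := h.eq_of_agree (h.agree_symm hbk) hkw hbw
  have h' := h.neg_right
  have h3 := h'.eq_of_agree hak haw (by rwa [neg_neg])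
  have h4 := h'.eq_of_agree (h'.agree_symm haw) (h'.agree_symm hbw) (by rwa [neg_neg])
  refine ⟨h2, ?_⟩
  have h5 := h.pfaffian a b k w
  have e1 := hak.2
  have e2 := haw.2
  have e3 := hbw.2
  simp only [Pi.neg_apply] at e1 e2 e3
  rw [hab.2, hbk.2, hkw.2, show t a k = -s a k by linarith, show t a w = -s a w by linarith,
    show t b w = -s b w by linarith] at h5
  have f1 : s b k = - s k w := by rw [h.skew_left, h2]
  have f2 : s a b = s k w := by rw [h.skew_left, h1, f1]; ring
  have f3 : s b w = s a w := by rw [h.skew_left b w, ← h4, ← h.skew_left]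
  rw [f1, f2, f3, h3] at h5
  have h6 : s k w * s a w * (s k w ^ 2 - s a w ^ 2) = 0 := by linarith
  rcases mul_eq_zero.1 h6 with h7 | h7
  · rcases mul_eq_zero.1 h7 with h8 | h8
    · exact absurd h8 hkw.1
    · exact absurd h8 haw.1
  · linarith

end SameMinors

end Agreement

/-! ### Splitting sets on which agreement and disagreement are both connected -/

section Connected

variable {V : Type*} {s t : V → V → ℝ} {W : Finset V}

/-- The vertices of `W` reachable from `v` inside `W` through agreeing pairs. -/
noncomputable def agreeComponent (s t : V → V → ℝ) (W : Finset V) (v : V) : Finset V :=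
  open Classical in
  W.filter (fun u => Relation.ReflTransGen (fun a b => b ∈ W ∧ Agree s t a b) v u)

lemma agreeComponent_subset (v : V) : agreeComponent s t W v ⊆ W := by
  classical exact Finset.filter_subset _ _

lemma mem_agreeComponent_self {v : V} (hv : v ∈ W) : v ∈ agreeComponent s t W v := by
  classical exact Finset.mem_filter.2 ⟨hv, Relation.ReflTransGen.refl⟩

lemma mem_agreeComponent_of_agree {v a b : V} (ha : a ∈ agreeComponent s t W v) (hb : b ∈ W)
    (hab : Agree s t a b) : b ∈ agreeComponent s t W v := by
  classical
  exact Finset.mem_filter.2 ⟨hb, (Finset.mem_filter.1 ha).2.tail ⟨hb, hab⟩⟩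

lemma agreeComponent_induction {v : V} (p : V → Prop) (hv : p v)
    (hstep : ∀ a ∈ agreeComponent s t W v, ∀ b ∈ agreeComponent s t W v, Agree s t a b → p a → p b)
    (hvW : v ∈ W) : ∀ u ∈ agreeComponent s t W v, p u := by
  classical
  intro u hu
  have h1 := (Finset.mem_filter.1 hu).2
  have h2 : p u ∧ u ∈ agreeComponent s t W v := by
    clear hu
    induction h1 with
    | refl => exact ⟨hv, mem_agreeComponent_self hvW⟩
    | tail _ hbc ih =>
      have h3 := mem_agreeComponent_of_agree ih.2 hbc.1 hbc.2
      exact ⟨hstep _ ih.2 _ h3 hbc.2 ih.1, h3⟩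
  exact h2.1

namespace SameMinors

variable (h : SameMinors s t)
include h

/-- An outside vertex without agreeing pairs to the component sees all its vertices in the
same way. -/
lemma eq_on_agreeComponent {v k : V} (hv : v ∈ W)
    (hk : ∀ u ∈ agreeComponent s t W v, ¬ Agree s t u k) :
    ∀ u ∈ agreeComponent s t W v, s u k = s v k := by
  refine agreeComponent_induction (fun u => s u k = s v k) rfl ?_ hv
  intro a ha b hb hab hak
  have h1 := h.eq_of_not_agree hab (fun h1 => hk a ha (h.agree_symm h1))
    (fun h1 => hk b hb (h.agree_symm h1))
  rw [← hak, h.skew_left, ← h1, ← h.skew_left]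

variable [DecidableEq V]

lemma agreeConnected_of_agreeComponent_eq {v : V} (hv : v ∈ W)
    (hW : agreeComponent s t W v = W) : AgreeConnected s t W := by
  intro C hCW hC hne
  by_contra! hcon
  by_cases hvC : v ∈ C
  · refine hne (Finset.Subset.antisymm hCW fun u hu => ?_)
    refine agreeComponent_induction (s := s) (t := t) (W := W) (· ∈ C) hvC ?_ hv u (hW.symm ▸ hu)
    intro a _ b hb hab haC
    by_contra hbC
    exact hcon a haC b (hW ▸ hb) hbC hab
  · obtain ⟨c, hc⟩ := hC
    refine agreeComponent_induction (s := s) (t := t) (W := W) (· ∉ C) hvC ?_ hv c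
      (hW.symm ▸ hCW hc) hc
    intro a ha b _ hab haC hbC
    exact hcon b hbC a (hW ▸ ha) haC (h.agree_symm hab)

/-- If agreement and disagreement are both connected on `W`, but agreement is disconnected after
deleting `k`, then `W` splits. One part is the agreement component `C` of a vertex in disagreement
with `k`, or its complement; `k` falls on one side according to the orientation of an alternating
4-path through `k`. -/
lemma exists_splits_of_erase {k : V} (hk : k ∈ W) (hpos : AgreeConnected s t W)
    (hneg : AgreeConnected s (-t) W) (hW : 2 ≤ W.card) (hdis : ¬ AgreeConnected s t (W.erase k)) :
    ∃ m, m ≠ 0 ∧ Splits s m W := by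
  have h' := h.neg_right
  obtain ⟨k', hk', v, hvW, hvk, hkv⟩ := hneg {k} (by simpa using hk) (by simp)
    (by intro h1; rw [← h1] at hW; simp at hW)
  rw [Finset.mem_singleton] at hk' hvk
  rw [hk'] at hkv
  have hv : v ∈ W.erase k := Finset.mem_erase.2 ⟨hvk, hvW⟩
  set C := agreeComponent s t (W.erase k) v with hC
  have hvC : v ∈ C := mem_agreeComponent_self hv
  have hCW : ∀ u ∈ C, u ≠ k ∧ u ∈ W := fun u hu =>
    Finset.mem_erase.1 (agreeComponent_subset v hu)
  set D := W.erase k \ C with hD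
  have hDmem : ∀ u, u ∈ D ↔ (u ≠ k ∧ u ∈ W) ∧ u ∉ C := by
    intro u; rw [hD, Finset.mem_sdiff, Finset.mem_erase]
  have hDne : D.Nonempty := by
    rw [Finset.nonempty_iff_ne_empty]
    intro h1
    exact hdis (h.agreeConnected_of_agreeComponent_eq hv
      (Finset.Subset.antisymm (agreeComponent_subset v) (Finset.sdiff_eq_empty_iff_subset.1 h1)))
  have hCD : ∀ u ∈ C, ∀ d ∈ D, ¬ Agree s t u d := by
    intro u hu d hd h1
    exact ((hDmem d).1 hd).2
      (mem_agreeComponent_of_agree hu (Finset.mem_erase.2 ((hDmem d).1 hd).1) h1)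
  have hrow : ∀ d ∈ D, ∀ u ∈ C, s u d = s v d := fun d hd =>
    h.eq_on_agreeComponent hv fun u hu => hCD u hu d hd
  obtain ⟨w, hw, k1, hk1, hkD, hkw⟩ := hpos D (fun u hu => ((hDmem u).1 hu).1.2) hDne
    (by intro h1; rw [← h1] at hk; exact ((hDmem k).1 hk).1.1 rfl)
  have hk1k : k1 = k := by
    by_contra h1
    by_cases h2 : k1 ∈ C
    · exact hCD k1 h2 w hw (h.agree_symm hkw)
    · exact hkD ((hDmem k1).2 ⟨⟨h1, hk1⟩, h2⟩)
  rw [hk1k] at hkw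
  replace hkw := h.agree_symm hkw
  set c := s v k with hc
  have hcne : c ≠ 0 := (h'.agree_symm hkv).1
  -- the value between `v` and an agreement neighbour of `k` in `D`
  have hvP : ∀ d ∈ D, Agree s t k d → s v d = c := by
    intro d hd h1
    have h2 : s v d ≠ 0 := by
      have := h.ne_zero_of_agree h1 hkv
      rw [h.skew_left] at this
      simpa using this
    have h3 := (h.agree_or h2).resolve_left (hCD v hvC d hd)
    exact h'.eq_of_agree h3 (h'.agree_symm hkv) (by rw [neg_neg]; exact h.agree_symm h1)
  have hvD : ∀ d ∈ D, s v d = c := by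
    by_contra! hcon
    obtain ⟨d0, hd0, hd0c⟩ := hcon
    obtain ⟨a, ha, b, hb, hbn, hab⟩ := hpos (D.filter (fun d => s v d ≠ c))
      (fun u hu => ((hDmem u).1 (Finset.mem_filter.1 hu).1).1.2)
      ⟨d0, Finset.mem_filter.2 ⟨hd0, hd0c⟩⟩
      (by intro h1; rw [← h1] at hk; exact ((hDmem _).1 (Finset.mem_filter.1 hk).1).1.1 rfl)
    rw [Finset.mem_filter] at ha
    by_cases h1 : b = k
    · subst h1
      exact ha.2 (hvP a ha.1 (h.agree_symm hab))
    by_cases h2 : b ∈ C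
    · exact hCD b h2 a ha.1 (h.agree_symm hab)
    have h3 : b ∈ D := (hDmem b).2 ⟨⟨h1, hb⟩, h2⟩
    have h4 : s v b = c := by
      by_contra h4
      exact hbn (Finset.mem_filter.2 ⟨h3, h4⟩)
    exact ha.2 ((h.eq_of_not_agree hab (hCD v hvC a ha.1) (hCD v hvC b h3)).trans h4)
  have hall : ∀ u ∈ C, ∀ d ∈ D, s u d = c := fun u hu d hd => (hrow d hd u hu).trans (hvD d hd)
  have hallneg : ∀ u ∈ C, ∀ d ∈ D, Agree s (-t) u d := fun u hu d hd =>
    (h.agree_or (by rw [hall u hu d hd]; exact hcne)).resolve_left (hCD u hu d hd)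
  -- an agreeing pair inside `C` whose ends are related to `k` in opposite ways
  obtain ⟨a, haC, hka, b, hbC, hkb, hab⟩ : ∃ a ∈ C, Agree s (-t) k a ∧ ∃ b ∈ C, Agree s t k b ∧
      Agree s t a b := by
    classical
    obtain ⟨a, ha, b, hb, hbn, hab⟩ := hpos (C.filter (fun u => Agree s (-t) k u))
      (fun u hu => (hCW u (Finset.mem_filter.1 hu).1).2)
      ⟨v, Finset.mem_filter.2 ⟨hvC, hkv⟩⟩
      (by intro h1; rw [← h1] at hk; exact (hCW _ (Finset.mem_filter.1 hk).1).1 rfl)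
    rw [Finset.mem_filter] at ha
    have h1 : b ≠ k := by
      rintro rfl
      exact (h.agree_symm hab).not_agree_neg ha.2
    have h2 : b ∈ C := mem_agreeComponent_of_agree ha.1 (Finset.mem_erase.2 ⟨h1, hb⟩) hab
    have h3 := h.ne_zero_of_agree hab (h'.agree_symm ha.2)
    rw [h.skew_left] at h3
    refine ⟨a, ha.1, ha.2, b, h2, ?_, hab⟩
    exact (h.agree_or (by simpa using h3 : s k b ≠ 0)).resolve_right
      fun h4 => hbn (Finset.mem_filter.2 ⟨h2, h4⟩)
  have hpath : ∀ w ∈ D, Agree s t k w → s k b = s k w ∧ s k w ^ 2 = c ^ 2 := by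
    intro w hw hkw
    have := h.sq_eq_of_path hab (h.agree_symm hkb) hkw (h'.agree_symm hka) (hallneg a haC w hw)
      (hallneg b hbC w hw)
    rwa [hall a haC w hw] at this
  rcases sq_eq_sq_iff_eq_or_eq_neg.1 (hpath w hw hkw).2 with hx | hx
  · -- `k` joins `C`
    refine ⟨c, hcne, insert k C, D, by simp, hDne, ?_, ?_⟩
    · ext z
      rw [Finset.mem_union, Finset.mem_insert, hDmem]
      have := hCW z
      grind
    intro x hxm d hd
    rcases Finset.mem_insert.1 hxm with rfl | hxC
    · by_cases h1 : Agree s t x d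
      · rw [← (hpath d hd h1).1, (hpath w hw hkw).1, hx]
      · have h2 := h.ne_zero_of_agree (h.agree_symm hkb) (hallneg b hbC d hd)
        have h3 := (h.agree_or h2).resolve_left h1
        have h4 := h'.eq_of_agree (h'.agree_symm h3) (h'.agree_symm (hallneg b hbC d hd))
          (by rwa [neg_neg])
        rw [h.skew_left, h4, ← h.skew_left, hall b hbC d hd]
    · exact hall x hxC d hd
  · -- `k` joins the complement of `C`
    refine ⟨c, hcne, C, insert k D, ⟨v, hvC⟩, by simp, ?_, ?_⟩
    · ext z
      rw [Finset.mem_union, Finset.mem_insert, hDmem]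
      have := hCW z
      grind
    intro u hu d hd
    rcases Finset.mem_insert.1 hd with rfl | hdD
    · have huw := hallneg u hu w hw
      have h2 : s u d ≠ 0 := by
        have := h.ne_zero_of_agree (h.agree_symm hkw) (h'.agree_symm huw)
        rw [h.skew_left] at this
        simpa using this
      rcases h.agree_or h2 with h1 | h1
      · have h4 := h.eq_of_agree (h.agree_symm h1) hkw huw
        rw [h.skew_left, h4, hx, neg_neg]
      · rw [h'.eq_of_agree h1 huw (by rwa [neg_neg]), hall u hu w hw]
    · exact hall u hu d hdD

/-- A set on which agreement and disagreement are both connected has at least four elements. -/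
lemma four_le_card (hpos : AgreeConnected s t W) (hneg : AgreeConnected s (-t) W)
    (hW : 2 ≤ W.card) : 4 ≤ W.card := by
  have hne : ∀ x, {x} ≠ W := by
    rintro x h1
    rw [← h1] at hW
    simp at hW
  have hp : ∀ x ∈ W, ∃ y ∈ W, Agree s t x y := by
    intro x hx
    obtain ⟨a, ha, b, hb, -, hab⟩ := hpos {x} (by simpa using hx) (by simp) (hne x)
    rw [Finset.mem_singleton] at ha
    exact ⟨b, hb, ha ▸ hab⟩
  have hn : ∀ x ∈ W, ∃ y ∈ W, Agree s (-t) x y := by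
    intro x hx
    obtain ⟨a, ha, b, hb, -, hab⟩ := hneg {x} (by simpa using hx) (by simp) (hne x)
    rw [Finset.mem_singleton] at ha
    exact ⟨b, hb, ha ▸ hab⟩
  have hirr : ∀ x, s x x = 0 := fun x => by have := h.skew_left x x; linarith
  have hsymm := fun i j => h.agree_symm (i := i) (j := j)
  have hsymm' := fun i j => h.neg_right.agree_symm (i := i) (j := j)
  have hnot := fun i j => Agree.not_agree_neg (s := s) (t := t) (i := i) (j := j)
  have hirrp : ∀ x, ¬ Agree s t x x := fun x h1 => h1.1 (hirr x)
  have hirrn : ∀ x, ¬ Agree s (-t) x x := fun x h1 => h1.1 (hirr x)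
  by_contra hlt
  obtain hc | hc : W.card = 2 ∨ W.card = 3 := by omega
  · obtain ⟨x, y, hxy, rfl⟩ := Finset.card_eq_two.1 hc
    have h1 := hp x (by simp)
    have h2 := hn x (by simp)
    simp only [Finset.mem_insert, Finset.mem_singleton, exists_eq_or_imp, exists_eq_left] at h1 h2
    grind
  · obtain ⟨x, y, z, hxy, hxz, hyz, rfl⟩ := Finset.card_eq_three.1 hc
    simp only [Finset.mem_insert, Finset.mem_singleton, exists_eq_or_imp, exists_eq_left,
      forall_eq_or_imp, forall_eq] at hp hn
    grind

/-- A set on which agreement and disagreement are both connected splits. -/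
theorem exists_splits (hpos : AgreeConnected s t W) (hneg : AgreeConnected s (-t) W)
    (hW : 2 ≤ W.card) : ∃ m, m ≠ 0 ∧ Splits s m W := by
  induction hn : W.card using Nat.strong_induction_on generalizing W with
  | _ n ih =>
    by_cases hall : ∀ k ∈ W, AgreeConnected s t (W.erase k) ∧ AgreeConnected s (-t) (W.erase k)
    · have h4 := h.four_le_card hpos hneg hW
      have hcard : ∀ k ∈ W, (W.erase k).card = W.card - 1 := fun k hk =>
        Finset.card_erase_of_mem hk
      have h5 : 5 ≤ W.card := by
        obtain ⟨k, hk⟩ : W.Nonempty := Finset.card_pos.1 (by omega)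
        have h6 := h.four_le_card (hall k hk).1 (hall k hk).2 (by rw [hcard k hk]; omega)
        rw [hcard k hk] at h6
        omega
      refine exists_splits_of_forall_erase h.skew_left h5 fun k hk => ?_
      exact ih (W.erase k).card (by rw [hcard k hk]; omega) (hall k hk).1 (hall k hk).2
        (by rw [hcard k hk]; omega) rfl
    · push Not at hall
      obtain ⟨k, hk, hk'⟩ := hall
      by_cases h1 : AgreeConnected s t (W.erase k)
      · exact h.neg_right.exists_splits_of_erase hk hneg (by rwa [neg_neg]) hW (hk' h1)
      · exact h.exists_splits_of_erase hk hpos hneg hW h1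

/-- If no nontrivial set is seen uniformly by `s` from outside, and `s` and `t` agree on some pair,
then agreement is connected: its components are seen uniformly. -/
lemma agreeConnected_univ [Fintype V]
    (hprime : ∀ X : Finset V, (∀ i ∈ X, ∀ j ∈ X, ∀ k ∉ X, s i k = s j k) →
      X.card ≤ 1 ∨ X = Finset.univ) {i j : V} (hij : Agree s t i j) :
    AgreeConnected s t Finset.univ := by
  have hi := mem_agreeComponent_self (s := s) (t := t) (Finset.mem_univ i)
  have hj := mem_agreeComponent_of_agree hi (Finset.mem_univ j) hij
  refine h.agreeConnected_of_agreeComponent_eq (Finset.mem_univ i)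
    ((hprime _ ?_).resolve_left ?_)
  · intro x hx y hy k hk
    have h1 := h.eq_on_agreeComponent (Finset.mem_univ i) (k := k)
      fun u hu huk => hk (mem_agreeComponent_of_agree hu (Finset.mem_univ k) huk)
    rw [h1 x hx, h1 y hy]
  · intro h1
    have h2 := Finset.card_le_one.1 h1 i hi j hj
    have h3 := h.skew_left i i
    exact hij.1 (by rw [← h2]; linarith)

/-- Without nontrivial sets seen uniformly by `s`, the functions `s` and `t` agree everywhere or are
opposite everywhere. -/
theorem eq_or_eq_neg [Fintype V] (hV : 3 ≤ Fintype.card V)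
    (hprime : ∀ X : Finset V, (∀ i ∈ X, ∀ j ∈ X, ∀ k ∉ X, s i k = s j k) →
      X.card ≤ 1 ∨ X = Finset.univ) : t = s ∨ t = -s := by
  by_contra! hcon
  obtain ⟨h1, h2⟩ := hcon
  have hne : ∀ i j, t i j ≠ s i j → Agree s (-t) i j := by
    intro i j hij
    rcases sq_eq_sq_iff_eq_or_eq_neg.1 (h.sq i j) with h3 | h3
    · exact absurd h3.symm hij
    · refine ⟨fun h4 => hij ?_, h3.symm⟩
      linarith
  obtain ⟨i, j, hij⟩ : ∃ i j, Agree s (-t) i j := by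
    by_contra! h3
    exact h1 (funext₂ fun i j => by_contra fun h4 => h3 i j (hne i j h4))
  obtain ⟨i', j', hij'⟩ : ∃ i j, Agree s t i j := by
    by_contra! h3
    refine h2 (funext₂ fun i j => ?_)
    by_cases h4 : s i j = 0
    · have := h.sq i j
      rw [h4] at this
      simpa [h4] using this.symm
    · have h5 := ((h.agree_or h4).resolve_left (h3 i j)).2
      simp only [Pi.neg_apply] at h5 ⊢
      linarith
  obtain ⟨m, hm, X, Y, ⟨x, hx⟩, ⟨y, hy⟩, hXY, hc⟩ := h.exists_splits (W := Finset.univ)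
    (h.agreeConnected_univ hprime hij') (h.neg_right.agreeConnected_univ hprime hij)
    (by rw [Finset.card_univ]; omega)
  have hself : ∀ z, s z z = 0 := fun z => by have := h.skew_left z z; linarith
  have hdisj : ∀ z ∈ X, z ∉ Y := by
    intro z hz hz'
    have := hc z hz z hz'
    rw [hself] at this
    exact hm this.symm
  have hmem : ∀ z, z ∈ X ∨ z ∈ Y := fun z => by
    rw [← Finset.mem_union, hXY]; exact Finset.mem_univ z
  have hX : X.card ≤ 1 := by
    refine (hprime X ?_).resolve_right ?_
    · intro i hi j hj k hk
      have hkY := (hmem k).resolve_left hk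
      rw [hc i hi k hkY, hc j hj k hkY]
    · intro h3
      exact hdisj y (h3 ▸ Finset.mem_univ y) hy
  have hY : Y.card ≤ 1 := by
    refine (hprime Y ?_).resolve_right ?_
    · intro i hi j hj k hk
      have hkX := (hmem k).resolve_right hk
      rw [h.skew_left i, h.skew_left j, hc k hkX i hi, hc k hkX j hj]
    · intro h3
      exact hdisj x hx (h3 ▸ Finset.mem_univ x)
  have h3 := Finset.card_union_le X Y
  rw [hXY, Finset.card_univ] at h3
  omega

end SameMinors

end Connected

/-! ### Principal minors of generalized tournament matrices -/

section Tournament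

variable {n : ℕ} {A B : Matrix (Fin n) (Fin n) ℝ}

lemma principalMinor_map {k : ℕ} (M : Matrix (Fin n) (Fin n) ℝ) (f : Fin k ↪ Fin n) :
    principalMinor M (Finset.univ.map f) = (M.submatrix f f).det := by
  let e : Fin k ≃ (Finset.univ.map f : Finset (Fin n)) :=
    Equiv.ofBijective (fun i => ⟨f i, by simp⟩)
      ⟨fun i j hij => f.injective (by simpa using hij), fun ⟨x, hx⟩ => by
        obtain ⟨i, -, rfl⟩ := Finset.mem_map.1 hx
        exact ⟨i, rfl⟩⟩
  rw [principalMinor, ← Matrix.det_submatrix_equiv_self e, Matrix.submatrix_submatrix]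
  rfl

/-- The skew-symmetric part `M - Mᵗ`, as a function. -/
def skewPart (M : Matrix (Fin n) (Fin n) ℝ) (i j : Fin n) : ℝ := M i j - M j i

namespace IsGeneralizedTournamentMatrix

variable (hA : IsGeneralizedTournamentMatrix A)
include hA

lemma diag (i : Fin n) : A i i = 0 := by
  have := congrFun (congrFun hA.add_transpose i) i
  simp at this
  linarith

lemma apply_of_ne {i j : Fin n} (hij : i ≠ j) : A i j = (1 + skewPart A i j) / 2 := by
  have := congrFun (congrFun hA.add_transpose i) j
  simp [hij] at this
  rw [skewPart]
  linarith

lemma apply_swap_of_ne {i j : Fin n} (hij : i ≠ j) : A j i = (1 - skewPart A i j) / 2 := by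
  rw [hA.apply_of_ne hij.symm, skewPart, skewPart]
  ring

lemma ext_skewPart (hB : IsGeneralizedTournamentMatrix B) (h : skewPart B = skewPart A) :
    A = B := by
  ext i j
  by_cases hij : i = j
  · rw [hij, hA.diag, hB.diag]
  · rw [hA.apply_of_ne hij, hB.apply_of_ne hij, h]

lemma transpose : IsGeneralizedTournamentMatrix Aᵀ where
  nonneg i j := hA.nonneg j i
  add_transpose := by rw [Matrix.transpose_transpose, add_comm, hA.add_transpose]

lemma det_two {i j : Fin n} (hij : i ≠ j) :
    (A.submatrix ![i, j] ![i, j]).det = (skewPart A i j ^ 2 - 1) / 4 := by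
  rw [Matrix.det_fin_two]
  simp only [Matrix.submatrix_apply]
  simp [hA.diag, hA.apply_of_ne hij, hA.apply_swap_of_ne hij]
  ring

lemma det_three {i j k : Fin n} (hij : i ≠ j) (hik : i ≠ k) (hjk : j ≠ k) :
    (A.submatrix ![i, j, k] ![i, j, k]).det =
      (1 + skewPart A i j * skewPart A j k - skewPart A j k * skewPart A i k
        - skewPart A i k * skewPart A i j) / 4 := by
  rw [Matrix.det_fin_three]
  simp only [Matrix.submatrix_apply]
  simp [hA.diag, hA.apply_of_ne hij, hA.apply_swap_of_ne hij,
    hA.apply_of_ne hik, hA.apply_swap_of_ne hik, hA.apply_of_ne hjk, hA.apply_swap_of_ne hjk]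
  ring

/-- Up to terms determined by the minors of order two and three, the minor of order four is the
squared Pfaffian of the skew-symmetric part. -/
lemma det_four {i j k l : Fin n} (hij : i ≠ j) (hik : i ≠ k) (hil : i ≠ l) (hjk : j ≠ k)
    (hjl : j ≠ l) (hkl : k ≠ l) {a b c d e f : ℝ} (ha : skewPart A i j = a)
    (hb : skewPart A i k = b) (hc : skewPart A i l = c) (hd : skewPart A j k = d)
    (he : skewPart A j l = e) (hf : skewPart A k l = f) :
    (A.submatrix ![i, j, k, l] ![i, j, k, l]).det =
      ((a * f - b * e + c * d) ^ 2 - 3 - (a ^ 2 + b ^ 2 + c ^ 2 + d ^ 2 + e ^ 2 + f ^ 2)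
        - 2 * (a * d - d * b - b * a) - 2 * (a * e - e * c - c * a)
        - 2 * (b * f - f * c - c * b) - 2 * (d * f - f * e - e * d)) / 16 := by
  rw [Matrix.det_succ_row_zero, Fin.sum_univ_four]
  simp only [Matrix.det_fin_three, Matrix.submatrix_apply]
  simp [Fin.succAbove, hA.diag,
    hA.apply_of_ne hij, hA.apply_swap_of_ne hij,
    hA.apply_of_ne hik, hA.apply_swap_of_ne hik, hA.apply_of_ne hjk, hA.apply_swap_of_ne hjk,
    hA.apply_of_ne hil, hA.apply_swap_of_ne hil, hA.apply_of_ne hjl, hA.apply_swap_of_ne hjl,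
    hA.apply_of_ne hkl, hA.apply_swap_of_ne hkl, ha, hb, hc, hd, he, hf]
  ring

/-- A set seen uniformly by the skew-symmetric part is a clan. -/
lemma isClan {X : Finset (Fin n)}
    (hX : ∀ i ∈ X, ∀ j ∈ X, ∀ k ∉ X, skewPart A i k = skewPart A j k) : IsClan A X := by
  intro i hi j hj k hk
  have hik : i ≠ k := by rintro rfl; exact hk hi
  have hjk : j ≠ k := by rintro rfl; exact hk hj
  rw [hA.apply_of_ne hik, hA.apply_of_ne hjk, hA.apply_swap_of_ne hik, hA.apply_swap_of_ne hjk,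
    hX i hi j hj k hk]
  exact ⟨rfl, rfl⟩

end IsGeneralizedTournamentMatrix

lemma skewPart_skew (M : Matrix (Fin n) (Fin n) ℝ) (i j : Fin n) :
    skewPart M i j = -skewPart M j i := by
  rw [skewPart, skewPart]; ring

lemma skewPart_self (M : Matrix (Fin n) (Fin n) ℝ) (i : Fin n) : skewPart M i i = 0 := sub_self _

lemma sameMinors_skewPart (hA : IsGeneralizedTournamentMatrix A)
    (hB : IsGeneralizedTournamentMatrix B)
    (hminors : ∀ S : Finset (Fin n), S.card ≤ 4 → principalMinor A S = principalMinor B S) :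
    SameMinors (skewPart A) (skewPart B) := by
  have hdet : ∀ {k : ℕ} (f : Fin k → Fin n), k ≤ 4 → Function.Injective f →
      (A.submatrix f f).det = (B.submatrix f f).det := by
    intro k f hk hf
    have := hminors (Finset.univ.map ⟨f, hf⟩) (by simpa using hk)
    rwa [principalMinor_map, principalMinor_map] at this
  have hsq : ∀ i j, skewPart A i j ^ 2 = skewPart B i j ^ 2 := by
    intro i j
    by_cases hij : i = j
    · rw [hij, skewPart_self, skewPart_self]
    have h2 := hdet ![i, j] (by norm_num) (by
      intro x y hxy
      fin_cases x <;> fin_cases y <;> simp_all)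
    rw [hA.det_two hij, hB.det_two hij] at h2
    linarith
  have htri : ∀ i j k, skewPart A i j * skewPart A j k + skewPart A j k * skewPart A k i +
      skewPart A k i * skewPart A i j = skewPart B i j * skewPart B j k +
      skewPart B j k * skewPart B k i + skewPart B k i * skewPart B i j := by
    intro i j k
    rw [skewPart_skew A k i, skewPart_skew B k i]
    by_cases hij : i = j
    · subst hij
      rw [skewPart_self, skewPart_self]
      linarith [hsq i k]
    by_cases hik : i = k
    · subst hik
      rw [skewPart_self, skewPart_self, skewPart_skew A j i, skewPart_skew B j i]
      linarith [hsq i j]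
    by_cases hjk : j = k
    · subst hjk
      rw [skewPart_self, skewPart_self]
      linarith [hsq i j]
    have h3 := hdet ![i, j, k] (by norm_num) (by
      intro x y hxy
      fin_cases x <;> fin_cases y <;> simp_all)
    rw [hA.det_three hij hik hjk, hB.det_three hij hik hjk] at h3
    linarith
  refine ⟨skewPart_skew A, skewPart_skew B, hsq, htri, fun i j k l => ?_⟩
  -- with two equal indices the Pfaffian vanishes
  have hA0 := skewPart_self A
  have hB0 := skewPart_self B
  by_cases hij : i = j
  · subst hij; rw [hA0, hB0]; ring
  by_cases hik : i = k
  · subst hik; rw [hA0, hB0, skewPart_skew A j i, skewPart_skew B j i]; ring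
  by_cases hil : i = l
  · subst hil
    rw [hA0, hB0, skewPart_skew A j i, skewPart_skew B j i, skewPart_skew A k i,
      skewPart_skew B k i]
    ring
  by_cases hjk : j = k
  · subst hjk; rw [hA0, hB0]; ring
  by_cases hjl : j = l
  · subst hjl; rw [hA0, hB0, skewPart_skew A k j, skewPart_skew B k j]; ring
  by_cases hkl : k = l
  · subst hkl; rw [hA0, hB0]; ring
  have h4 := hdet ![i, j, k, l] le_rfl (by
    intro x y hxy
    fin_cases x <;> fin_cases y <;> simp_all)
  rw [hA.det_four hij hik hil hjk hjl hkl rfl rfl rfl rfl rfl rfl,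
    hB.det_four hij hik hil hjk hjl hkl rfl rfl rfl rfl rfl rfl] at h4
  have h5 := htri i j k
  have h6 := htri i j l
  have h7 := htri i k l
  have h8 := htri j k l
  rw [skewPart_skew A k i, skewPart_skew B k i] at h5
  rw [skewPart_skew A l i, skewPart_skew B l i] at h6 h7
  rw [skewPart_skew A l j, skewPart_skew B l j] at h8
  linarith [hsq i j, hsq i k, hsq i l, hsq j k, hsq j l, hsq k l]

end Tournament

theorem theorem4p1 {n : ℕ} (hn : 4 ≤ n) (A B : Matrix (Fin n) (Fin n) ℝ)
    (hA : IsGeneralizedTournamentMatrix A) (hB : IsGeneralizedTournamentMatrix B)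
    (hind : IsIndecomposable A)
    (hminors : ∀ S : Finset (Fin n), S.card ≤ 4 → principalMinor A S = principalMinor B S) :
    A = B ∨ A = Bᵀ := by
  have h := sameMinors_skewPart hA hB hminors
  have hprime : ∀ X : Finset (Fin n),
      (∀ i ∈ X, ∀ j ∈ X, ∀ k ∉ X, skewPart A i k = skewPart A j k) →
      X.card ≤ 1 ∨ X = Finset.univ := by
    intro X hX
    rcases hind X (hA.isClan hX) with rfl | ⟨i, rfl⟩ | rfl <;> simp
  rcases h.eq_or_eq_neg (by rw [Fintype.card_fin]; omega) hprime with h1 | h1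
  · exact Or.inl (hA.ext_skewPart hB h1)
  · refine Or.inr (hA.ext_skewPart hB.transpose ?_)
    funext i j
    have h2 := congrFun (congrFun h1 j) i
    simp only [Pi.neg_apply] at h2
    change skewPart B j i = _
    rw [h2, ← skewPart_skew]
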